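/- Let $m>n$ be natural numbers and let $C_1,\dots,C_m\in\mathbb{R}^n$ be points whose convex hull has nonempty interior and such that each facet (i.e. $(n-1)$-dimensional face) of $\operatorname{conv}\{C_1,\dots,C_m\}$ contains at most $n$ of the points $C_1,\dots,C_m$, counted by index (so that a repeated point counts repeatedly). Let $r>0$ be such that $$\mathcal{Q}=\bigcap_{k=1}^m\{x\in\mathbb{R}^n : \|x-C_k\|\le r\}$$ is nonempty. Let $C_0\in\partial\operatorname{conv}\{C_1,\dots,C_m\}$ satisfy $C_0=\sum_{k=1}^p\alpha_k C_{\sigma_k}$, where $p\le n$, $\alpha_k>0$ for all $k$, $\sum_{k=1}^p\alpha_k=1$, and $\sigma_1,\dots,\sigma_p\in\{1,\dots,m\}$ are pairwise distinct indices. Call $x\in\mathcal{Q}$ a solution if $\|y-C_0\|\le\|x-C_0\|$ for all $y\in\mathcal{Q}$, i.e. if it solves $\max_{x\in\mathcal{Q}}\|x-C_0\|$. Then: 1. if $p=n$, the number of solutions is exactly one or exactly two; 2. if $p<n$, there is either exactly one solution, or the set of solutions is uncountable. -/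

import Mathlib

/-- The convex hull of a family of points `C 1, …, C m` of `ℝⁿ`. -/
def centerHull {n m : ℕ} (C : Fin m → EuclideanSpace ℝ (Fin n)) : Set (EuclideanSpace ℝ (Fin n)) :=
  convexHull ℝ (Set.range C)

/-- `F` is a facet of `K`: a nonempty exposed face of `K` (the intersection of `K` with a
supporting hyperplane) whose dimension is one less than the dimension of `K`. -/
def IsFacet {n : ℕ} (K F : Set (EuclideanSpace ℝ (Fin n))) : Prop :=
  F.Nonempty ∧ IsExposed ℝ K F ∧
    Module.finrank ℝ (vectorSpan ℝ F) + 1 = Module.finrank ℝ (vectorSpan ℝ K)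

/-- The convex hull of the centers has full dimension, and each of its facets contains at most
`n` of the centers (counted by index, so a repeated center counts repeatedly). -/
def FacetsInGeneralPosition {n m : ℕ} (C : Fin m → EuclideanSpace ℝ (Fin n)) : Prop :=
  (interior (centerHull C)).Nonempty ∧
    ∀ F : Set (EuclideanSpace ℝ (Fin n)), IsFacet (centerHull C) F → {k : Fin m | C k ∈ F}.ncard ≤ n

/-- The intersection of the closed balls of radius `r` around the centers. -/
def ballIntersection {n m : ℕ} (C : Fin m → EuclideanSpace ℝ (Fin n)) (r : ℝ) :
    Set (EuclideanSpace ℝ (Fin n)) :=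
  ⋂ k : Fin m, Metric.closedBall (C k) r

/-- The set of solutions of the problem of maximizing `‖x - C₀‖` over `x ∈ Q`. -/
def farthestPoints {n : ℕ} (Q : Set (EuclideanSpace ℝ (Fin n))) (C₀ : EuclideanSpace ℝ (Fin n)) :
    Set (EuclideanSpace ℝ (Fin n)) :=
  {x | x ∈ Q ∧ ∀ y ∈ Q, ‖y - C₀‖ ≤ ‖x - C₀‖}

open scoped InnerProductSpace

section Normals

variable {E : Type*} [NormedAddCommGroup E] [InnerProductSpace ℝ E]

/-- A nonzero vector of the polar cone of a finite spanning family can be chosen so that the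
members of the family orthogonal to it determine it up to a scalar. -/
theorem exists_extreme_normal {ι : Type*} [Fintype ι] (v : ι → E)
    (hv : ∀ e : E, (∀ k, ⟪e, v k⟫_ℝ = 0) → e = 0)
    (hd : ∃ d : E, d ≠ 0 ∧ ∀ k, ⟪d, v k⟫_ℝ ≤ 0) :
    ∃ d : E, d ≠ 0 ∧ (∀ k, ⟪d, v k⟫_ℝ ≤ 0) ∧
      ∀ e : E, (∀ k, ⟪d, v k⟫_ℝ = 0 → ⟪e, v k⟫_ℝ = 0) → ∃ c : ℝ, e = c • d := by
  classical
  let active : E → Finset ι := fun d => Finset.univ.filter fun k => ⟪d, v k⟫_ℝ = 0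
  let S : Set ℕ := {N | ∃ d : E, (d ≠ 0 ∧ ∀ k, ⟪d, v k⟫_ℝ ≤ 0) ∧ (active d).card = N}
  have hS : S.Nonempty := by
    obtain ⟨d, hd⟩ := hd
    exact ⟨_, d, hd, rfl⟩
  have hSb : BddAbove S := ⟨Fintype.card ι, by
    rintro _ ⟨d, -, rfl⟩
    exact Finset.card_le_univ _⟩
  obtain ⟨d, ⟨hd0, hdle⟩, hdcard⟩ := Nat.sSup_mem hS hSb
  refine ⟨d, hd0, hdle, fun e he => ?_⟩
  by_contra hne
  have key : ∀ e : E, (∀ k, ⟪d, v k⟫_ℝ = 0 → ⟪e, v k⟫_ℝ = 0) → (¬ ∃ c : ℝ, e = c • d) →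
      ∀ k, ⟪e, v k⟫_ℝ ≤ 0 := by
    intro e he hne
    by_contra! hpos
    obtain ⟨k₀, hk₀⟩ := hpos
    obtain ⟨k, hk, hmin⟩ := Finset.exists_min_image
      (Finset.univ.filter fun k => 0 < ⟪e, v k⟫_ℝ) (fun k => -⟪d, v k⟫_ℝ / ⟪e, v k⟫_ℝ)
      ⟨k₀, by simpa using hk₀⟩
    simp only [Finset.mem_filter, Finset.mem_univ, true_and] at hk hmin
    set t : ℝ := -⟪d, v k⟫_ℝ / ⟪e, v k⟫_ℝ with ht
    have ht0 : 0 ≤ t := div_nonneg (by linarith [hdle k]) hk.le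
    have hdk : ⟪d, v k⟫_ℝ ≠ 0 := fun h => hk.ne' (he k h)
    have htpos : t ≠ 0 := div_ne_zero (neg_ne_zero.2 hdk) hk.ne'
    have hmem : (active (d + t • e)).card ∈ S := by
      refine ⟨d + t • e, ⟨fun h => hne ⟨-t⁻¹, ?_⟩, fun j => ?_⟩, rfl⟩
      · have h' : t • e = -d := by rw [eq_neg_iff_add_eq_zero, add_comm]; exact h
        rw [neg_smul, ← smul_neg, ← h', smul_smul, inv_mul_cancel₀ htpos, one_smul]
      · rw [inner_add_left, real_inner_smul_left]
        by_cases hj : 0 < ⟪e, v j⟫_ℝ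
        · have := (le_div_iff₀ hj).1 (hmin j hj)
          linarith
        · have := mul_nonneg ht0 (neg_nonneg.2 (not_lt.1 hj))
          linarith [hdle j]
    have hlt : (active d).card < (active (d + t • e)).card := by
      apply Finset.card_lt_card
      rw [Finset.ssubset_iff_of_subset]
      · refine ⟨k, ?_, ?_⟩
        · simp only [active, Finset.mem_filter, Finset.mem_univ, true_and]
          rw [inner_add_left, real_inner_smul_left, ht, div_mul_cancel₀ _ hk.ne']
          ring
        · simpa [active] using hdk
      · intro j hj
        simp only [active, Finset.mem_filter, Finset.mem_univ, true_and] at hj ⊢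
        rw [inner_add_left, real_inner_smul_left, hj, he j hj]
        ring
    have := le_csSup hSb hmem
    omega
  have h1 := key e he hne
  have h2 := key (-e) (fun k hk => by rw [inner_neg_left, he k hk, neg_zero])
    (fun ⟨c, hc⟩ => hne ⟨-c, by rw [neg_smul, ← hc, neg_neg]⟩)
  have h3 : e = 0 := hv e fun k => by
    have := h2 k
    rw [inner_neg_left] at this
    linarith [h1 k]
  exact hne ⟨0, by simp [h3]⟩

/-- If the members of the family `v` indexed by `A` determine `d` up to a scalar, if `A` has at most
`dim E` elements, and if `∑ α j • v (σ j) = 0`, then the inner products of a vector with the members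
indexed by `A` can be prescribed subject to the induced linear relation only. -/
theorem exists_inner_eq [FiniteDimensional ℝ E] {ι κ : Type*} [Fintype ι] [Fintype κ]
    {v : ι → E} {A : Finset ι} {d : E} (hd0 : d ≠ 0)
    (hdA : ∀ k ∈ A, ⟪d, v k⟫_ℝ = 0)
    (hspan : ∀ e : E, (∀ k ∈ A, ⟪e, v k⟫_ℝ = 0) → ∃ c : ℝ, e = c • d)
    {σ : κ → ι} (hσA : ∀ j, σ j ∈ A) {α : κ → ℝ} (hα : ∑ j, α j = 1)
    (hrel : ∑ j, α j • v (σ j) = 0) (hcard : A.card ≤ Module.finrank ℝ E) :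
    A.card = Module.finrank ℝ E ∧
    ∀ y : ι → ℝ, ∑ j, α j * y (σ j) = 0 → ∃ u : E, ∀ k ∈ A, ⟪u, v k⟫_ℝ = y k := by
  classical
  let φ : E →ₗ[ℝ] (A → ℝ) := LinearMap.pi fun k => (innerₗ E).flip (v k)
  let ψ : (A → ℝ) →ₗ[ℝ] ℝ := ∑ j, α j • LinearMap.proj (⟨σ j, hσA j⟩ : A)
  have hφ : ∀ u k, φ u k = ⟪u, v k⟫_ℝ := fun u k => rfl
  have hψ : ∀ y : A → ℝ, ψ y = ∑ j, α j * y ⟨σ j, hσA j⟩ := fun y => by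
    simp [ψ, LinearMap.sum_apply]
  have hker : LinearMap.ker φ = Submodule.span ℝ {d} := by
    ext e
    rw [LinearMap.mem_ker, Submodule.mem_span_singleton]
    constructor
    · intro h
      obtain ⟨c, hc⟩ := hspan e fun k hk => by
        rw [← hφ e ⟨k, hk⟩, h]; rfl
      exact ⟨c, hc.symm⟩
    · rintro ⟨c, rfl⟩
      ext k
      rw [hφ, real_inner_smul_left, hdA k k.2, mul_zero]
      rfl
  have hrange : LinearMap.range φ ≤ LinearMap.ker ψ := by
    rintro _ ⟨u, rfl⟩
    rw [LinearMap.mem_ker, hψ]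
    simp only [hφ]
    simp only [← real_inner_smul_right, ← inner_sum]
    rw [hrel, inner_zero_right]
  have hψsurj : Function.Surjective ψ := fun c =>
    ⟨fun _ => c, by rw [hψ, ← Finset.sum_mul, hα, one_mul]⟩
  have h1 := LinearMap.finrank_range_add_finrank_ker φ
  have h2 := LinearMap.finrank_range_add_finrank_ker ψ
  rw [hker, finrank_span_singleton hd0] at h1
  rw [LinearMap.range_eq_top.2 hψsurj, finrank_top, Module.finrank_self,
    Module.finrank_fintype_fun_eq_card, Fintype.card_coe] at h2
  have h3 := Submodule.finrank_mono hrange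
  have heq : LinearMap.range φ = LinearMap.ker ψ :=
    Submodule.eq_of_le_of_finrank_le hrange (by omega)
  refine ⟨by omega, fun y hy => ?_⟩
  have hmem : (fun k : A => y k) ∈ LinearMap.range φ := by
    rw [heq, LinearMap.mem_ker, hψ]
    exact hy
  obtain ⟨u, hu⟩ := hmem
  exact ⟨u, fun k hk => by rw [← hφ u ⟨k, hk⟩, hu]⟩

end Normals

section Relaxation

variable {E : Type*} [NormedAddCommGroup E] [InnerProductSpace ℝ E]

theorem norm_sub_smul_sub_sq (x d c : E) (t : ℝ) :
    ‖x - t • d - c‖ ^ 2 = ‖x - c‖ ^ 2 - 2 * t * ⟪d, x - c⟫_ℝ + t ^ 2 * ‖d‖ ^ 2 := by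
  rw [show x - t • d - c = (x - c) - t • d by abel, norm_sub_sq_real, real_inner_smul_right,
    real_inner_comm, norm_smul, mul_pow, Real.norm_eq_abs, sq_abs]
  ring

/-- Moving against a normal vector `d` at `c₀` raises the squared distance to `c₀` by any prescribed
amount `s ≥ 0`, and raises the squared distance to the other centers by no more than that. -/
theorem exists_move_against_normal {ι : Type*} {C : ι → E} {c₀ d : E} (hd0 : d ≠ 0)
    (hd : ∀ k, ⟪d, C k - c₀⟫_ℝ ≤ 0) (x : E) {s : ℝ} (hs : 0 ≤ s) :
    ∃ t : ℝ, 0 ≤ t ∧ ‖x - t • d - c₀‖ ^ 2 = ‖x - c₀‖ ^ 2 + s ∧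
      ∀ k, ‖x - t • d - C k‖ ^ 2 ≤ ‖x - C k‖ ^ 2 + s := by
  have hd2 : 0 < ‖d‖ ^ 2 := by positivity
  set b := ⟪d, x - c₀⟫_ℝ with hb
  obtain ⟨t, ht, hts⟩ : ∃ t : ℝ, 0 ≤ t ∧ t ^ 2 * ‖d‖ ^ 2 - 2 * t * b = s := by
    set D := ‖d‖ ^ 2 with hD
    have hdisc : 0 ≤ b ^ 2 + D * s := by positivity
    have hsq := Real.sq_sqrt hdisc
    have habs : |b| ≤ √(b ^ 2 + D * s) := Real.abs_le_sqrt (by nlinarith [mul_nonneg hd2.le hs])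
    refine ⟨(b + √(b ^ 2 + D * s)) / D, div_nonneg (by linarith [neg_abs_le b]) hd2.le, ?_⟩
    field_simp
    linarith
  have h0 : ‖x - t • d - c₀‖ ^ 2 = ‖x - c₀‖ ^ 2 + s := by
    rw [norm_sub_smul_sub_sq, ← hts]
    ring
  refine ⟨t, ht, h0, fun k => ?_⟩
  have h1 : ⟪d, x - C k⟫_ℝ = b - ⟪d, C k - c₀⟫_ℝ := by
    rw [hb, ← inner_sub_right]
    congr 1
    abel
  rw [norm_sub_smul_sub_sq, h1, ← hts]
  nlinarith [mul_nonneg ht (neg_nonneg.2 (hd k))]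

theorem norm_midpoint_sub_sq (a b c : E) :
    ‖midpoint ℝ a b - c‖ ^ 2 + ‖a - b‖ ^ 2 / 4 = (‖a - c‖ ^ 2 + ‖b - c‖ ^ 2) / 2 := by
  have h := parallelogram_law_with_norm ℝ (a - c) (b - c)
  have h1 : (a - c) + (b - c) = (2 : ℝ) • (midpoint ℝ a b - c) := by
    rw [midpoint_eq_smul_add, smul_sub, smul_smul, two_smul ℝ c, mul_invOf_self, one_smul]
    abel
  rw [h1, norm_smul, sub_sub_sub_cancel_right, Real.norm_eq_abs, abs_two] at h
  linarith

/-- Three points of a line at the same distance from a point are not distinct. -/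
theorem eq_or_eq_of_collinear_of_norm_eq {a d c : E} {s t : ℝ}
    (hs : ‖a - s • d - c‖ = ‖a - c‖) (ht : ‖a - t • d - c‖ = ‖a - c‖) (hs0 : s • d ≠ 0)
    (ht0 : t • d ≠ 0) : s = t := by
  have h1 := norm_sub_smul_sub_sq a d c s
  have h2 := norm_sub_smul_sub_sq a d c t
  rw [hs] at h1
  rw [ht] at h2
  obtain ⟨hs0, hd0⟩ := smul_ne_zero_iff.1 hs0
  obtain ⟨ht0, -⟩ := smul_ne_zero_iff.1 ht0
  have hd2 : ‖d‖ ^ 2 ≠ 0 := by positivity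
  have h3 : s * ‖d‖ ^ 2 = 2 * ⟪d, a - c⟫_ℝ := mul_left_cancel₀ hs0 (by linarith)
  have h4 : t * ‖d‖ ^ 2 = 2 * ⟪d, a - c⟫_ℝ := mul_left_cancel₀ ht0 (by linarith)
  exact mul_right_cancel₀ hd2 (h3.trans h4.symm)

end Relaxation

section Facets

variable {n m : ℕ} {C : Fin m → EuclideanSpace ℝ (Fin n)} {c₀ : EuclideanSpace ℝ (Fin n)}

theorem isCompact_centerHull (C : Fin m → EuclideanSpace ℝ (Fin n)) :
    IsCompact (centerHull C) :=
  (Set.finite_range C).isCompact_convexHull ℝ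

theorem mem_centerHull (k : Fin m) : C k ∈ centerHull C :=
  subset_convexHull ℝ _ ⟨k, rfl⟩

theorem mem_centerHull_of_mem_frontier (hc : c₀ ∈ frontier (centerHull C)) :
    c₀ ∈ centerHull C :=
  (isCompact_centerHull C).isClosed.frontier_subset hc

theorem exists_normal_of_mem_frontier (hi : (interior (centerHull C)).Nonempty)
    (hc : c₀ ∈ frontier (centerHull C)) :
    ∃ d, d ≠ 0 ∧ ∀ k, ⟪d, C k - c₀⟫_ℝ ≤ 0 := by
  have hconv : Convex ℝ (centerHull C) := convex_convexHull ℝ _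
  obtain ⟨f, hf⟩ := geometric_hahn_banach_open_point hconv.interior isOpen_interior hc.2
  have hle : ∀ x ∈ centerHull C, f x ≤ f c₀ := by
    intro x hx
    have hx' : x ∈ closure (interior (centerHull C)) := by
      rw [hconv.closure_interior_eq_closure_of_nonempty_interior hi]
      exact subset_closure hx
    exact closure_minimal (fun y hy => (hf y hy).le)
      (isClosed_le f.continuous continuous_const) hx'
  set d := (InnerProductSpace.toDual ℝ (EuclideanSpace ℝ (Fin n))).symm f with hd
  have hfd : ∀ x, ⟪d, x⟫_ℝ = f x := fun x => InnerProductSpace.toDual_symm_apply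
  refine ⟨d, fun h0 => ?_, fun k => ?_⟩
  · obtain ⟨x, hx⟩ := hi
    have := hf x hx
    rw [← hfd, ← hfd, h0, inner_zero_left, inner_zero_left] at this
    exact this.false
  · rw [inner_sub_right, hfd, hfd]
    linarith [hle _ (mem_centerHull k)]

theorem eq_zero_of_inner_centers_eq_zero (hi : (interior (centerHull C)).Nonempty)
    {e : EuclideanSpace ℝ (Fin n)} (he : ∀ k, ⟪e, C k - c₀⟫_ℝ = 0) : e = 0 := by
  have hsub : Set.range C ⊆ {x | ⟪e, x⟫_ℝ = ⟪e, c₀⟫_ℝ} := by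
    rintro _ ⟨k, rfl⟩
    have := he k
    rw [inner_sub_right] at this
    exact sub_eq_zero.1 this
  have hK : centerHull C ⊆ {x | ⟪e, x⟫_ℝ = ⟪e, c₀⟫_ℝ} :=
    convexHull_min hsub (convex_hyperplane (innerₗ _ e).isLinear _)
  obtain ⟨x, hx⟩ := hi
  have hev : ∀ᶠ t : ℝ in nhds 0, x + t • e ∈ centerHull C := by
    have hcont : Filter.Tendsto (fun t : ℝ => x + t • e) (nhds 0) (nhds x) := by
      have : Continuous fun t : ℝ => x + t • e := by fun_prop
      simpa using this.tendsto 0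
    exact hcont.eventually (mem_interior_iff_mem_nhds.1 hx)
  obtain ⟨t, ht, ht0⟩ := ((hev.filter_mono nhdsWithin_le_nhds).and
    (self_mem_nhdsWithin (s := {0}ᶜ) (a := (0 : ℝ)))).exists
  have h1 := hK ht
  have h2 := hK (interior_subset hx)
  simp only [Set.mem_ofPred_eq, inner_add_right, real_inner_smul_right] at h1 h2
  have h3 : t * ⟪e, e⟫_ℝ = 0 := by linarith
  exact inner_self_eq_zero.1 ((mul_eq_zero.1 h3).resolve_left ht0)

/-- The exposed face cut out by an extreme normal vector is a facet. -/
theorem isFacet_of_extreme_normal (hi : (interior (centerHull C)).Nonempty)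
    (hc : c₀ ∈ centerHull C) {d : EuclideanSpace ℝ (Fin n)} (hd0 : d ≠ 0)
    (hd : ∀ k, ⟪d, C k - c₀⟫_ℝ ≤ 0)
    (hspan : ∀ e, (∀ k, ⟪d, C k - c₀⟫_ℝ = 0 → ⟪e, C k - c₀⟫_ℝ = 0) → ∃ c : ℝ, e = c • d) :
    IsFacet (centerHull C) {x ∈ centerHull C | ⟪d, x⟫_ℝ = ⟪d, c₀⟫_ℝ} := by
  set F := {x ∈ centerHull C | ⟪d, x⟫_ℝ = ⟪d, c₀⟫_ℝ} with hF
  have hsub : Set.range C ⊆ {x | ⟪d, x⟫_ℝ ≤ ⟪d, c₀⟫_ℝ} := by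
    rintro _ ⟨k, rfl⟩
    have := hd k
    rw [inner_sub_right] at this
    exact sub_nonpos.1 this
  have hK : centerHull C ⊆ {x | ⟪d, x⟫_ℝ ≤ ⟪d, c₀⟫_ℝ} :=
    convexHull_min hsub (convex_halfSpace_le (innerₗ _ d).isLinear _)
  have hcF : c₀ ∈ F := ⟨hc, rfl⟩
  refine ⟨⟨c₀, hcF⟩, fun _ => ⟨innerSL ℝ d, ?_⟩, ?_⟩
  · ext x
    simp only [hF, Set.mem_ofPred_eq, innerSL_apply_apply]
    refine and_congr_right fun hx => ⟨fun h y hy => h ▸ hK hy, fun h => ?_⟩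
    exact le_antisymm (hK hx) (h _ hc)
  · have hvec : vectorSpan ℝ F = (Submodule.span ℝ {d})ᗮ := by
      apply le_antisymm
      · rw [vectorSpan_def, Submodule.span_le]
        rintro _ ⟨x, hx, y, hy, rfl⟩
        rw [SetLike.mem_coe, Submodule.mem_orthogonal_singleton_iff_inner_right]
        change ⟪d, x - y⟫_ℝ = 0
        rw [inner_sub_right, hx.2, hy.2, sub_self]
      · rw [← Submodule.orthogonal_orthogonal (vectorSpan ℝ F)]
        apply Submodule.orthogonal_le
        intro e he
        obtain ⟨c, rfl⟩ := hspan e fun k hk => by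
          rw [real_inner_comm]
          refine (Submodule.mem_orthogonal _ _).1 he _ (vsub_mem_vectorSpan ℝ ?_ hcF)
          refine ⟨mem_centerHull k, ?_⟩
          rw [inner_sub_right] at hk
          exact sub_eq_zero.1 hk
        exact Submodule.smul_mem _ _ (Submodule.mem_span_singleton_self d)
    have htop : vectorSpan ℝ (centerHull C) = ⊤ := by
      have h := interior_convexHull_nonempty_iff_affineSpan_eq_top.1 hi
      rw [← direction_affineSpan, centerHull, affineSpan_convexHull, h, AffineSubspace.direction_top]
    have h1 := Submodule.finrank_add_finrank_orthogonal (Submodule.span ℝ {d})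
    rw [finrank_span_singleton hd0] at h1
    rw [hvec, htop, finrank_top]
    omega

/-- A boundary point of the hull has a normal vector whose orthogonal centers determine it up to
a scalar and are at most `n` in number. -/
theorem exists_facet_normal (hC : FacetsInGeneralPosition C)
    (hc : c₀ ∈ frontier (centerHull C)) :
    ∃ d, d ≠ 0 ∧ (∀ k, ⟪d, C k - c₀⟫_ℝ ≤ 0) ∧
      (∀ e, (∀ k, ⟪d, C k - c₀⟫_ℝ = 0 → ⟪e, C k - c₀⟫_ℝ = 0) → ∃ c : ℝ, e = c • d) ∧
      (Finset.univ.filter fun k => ⟪d, C k - c₀⟫_ℝ = 0).card ≤ n := by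
  obtain ⟨hi, hfac⟩ := hC
  obtain ⟨d, hd0, hd, hspan⟩ := exists_extreme_normal (fun k => C k - c₀)
    (fun e => eq_zero_of_inner_centers_eq_zero hi) (exists_normal_of_mem_frontier hi hc)
  refine ⟨d, hd0, hd, hspan, ?_⟩
  have h := hfac _ (isFacet_of_extreme_normal hi (mem_centerHull_of_mem_frontier hc) hd0 hd hspan)
  rw [← Set.ncard_coe_finset]
  convert h using 2
  ext k
  simp [mem_centerHull, inner_sub_right, sub_eq_zero]

end Facets

section Solutions

variable {n m : ℕ} {C : Fin m → EuclideanSpace ℝ (Fin n)} {c₀ : EuclideanSpace ℝ (Fin n)} {r : ℝ}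

theorem mem_ballIntersection_iff (hr : 0 ≤ r) {x : EuclideanSpace ℝ (Fin n)} :
    x ∈ ballIntersection C r ↔ ∀ k, ‖x - C k‖ ^ 2 ≤ r ^ 2 := by
  simp only [ballIntersection, Set.mem_iInter, mem_closedBall_iff_norm]
  exact forall_congr' fun k => (pow_le_pow_iff_left₀ (norm_nonneg _) hr two_ne_zero).symm

theorem farthestPoints_nonempty [Nonempty (Fin m)] (hQ : (ballIntersection C r).Nonempty) :
    (farthestPoints (ballIntersection C r) c₀).Nonempty := by
  have hcl : IsClosed (ballIntersection C r) := isClosed_iInter fun _ => Metric.isClosed_closedBall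
  have hcomp : IsCompact (ballIntersection C r) :=
    (isCompact_closedBall (C (Classical.arbitrary _)) r).of_isClosed_subset hcl
      (Set.iInter_subset _ _)
  obtain ⟨x, hx, hmax⟩ := hcomp.exists_isMaxOn hQ
    (f := fun x => ‖x - c₀‖) (by fun_prop)
  exact ⟨x, hx, fun y hy => hmax hy⟩

theorem norm_eq_of_mem_farthestPoints {a b : EuclideanSpace ℝ (Fin n)}
    (ha : a ∈ farthestPoints (ballIntersection C r) c₀)
    (hb : b ∈ farthestPoints (ballIntersection C r) c₀) : ‖a - c₀‖ = ‖b - c₀‖ :=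
  le_antisymm (hb.2 a ha.1) (ha.2 b hb.1)

/-- A farthest point is also optimal for the relaxation in which a slack `s ≥ 0` is added to all
squared distances. -/
theorem relaxed_le_of_mem_farthestPoints (hr : 0 ≤ r) {d : EuclideanSpace ℝ (Fin n)}
    (hd0 : d ≠ 0) (hd : ∀ k, ⟪d, C k - c₀⟫_ℝ ≤ 0) {a : EuclideanSpace ℝ (Fin n)}
    (ha : a ∈ farthestPoints (ballIntersection C r) c₀) {x : EuclideanSpace ℝ (Fin n)} {s : ℝ}
    (hs : 0 ≤ s) (hx : ∀ k, ‖x - C k‖ ^ 2 + s ≤ r ^ 2) :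
    ‖x - c₀‖ ^ 2 + s ≤ ‖a - c₀‖ ^ 2 := by
  obtain ⟨t, -, h0, hk⟩ := exists_move_against_normal hd0 hd x hs
  rw [← h0]
  have := ha.2 _ ((mem_ballIntersection_iff hr).2 fun k => (hk k).trans (hx k))
  gcongr

/-- At a relaxed optimum with positive slack all centers that carry `c₀` are tight. -/
theorem relaxed_tight (hr : 0 ≤ r) {d : EuclideanSpace ℝ (Fin n)}
    (hd0 : d ≠ 0) (hd : ∀ k, ⟪d, C k - c₀⟫_ℝ ≤ 0) {p : ℕ} {σ : Fin p → Fin m}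
    (hσ : Function.Injective σ) {α : Fin p → ℝ} (hα : ∀ j, 0 < α j)
    (hpre : ∀ y : Fin m → ℝ, ∑ j, α j * y (σ j) = 0 →
      ∃ u, ∀ k, ⟪d, C k - c₀⟫_ℝ = 0 → ⟪u, C k - c₀⟫_ℝ = y k)
    {a : EuclideanSpace ℝ (Fin n)} (ha : a ∈ farthestPoints (ballIntersection C r) c₀)
    {x : EuclideanSpace ℝ (Fin n)} {s : ℝ} (hs : 0 < s)
    (hx : ∀ k, ‖x - C k‖ ^ 2 + s ≤ r ^ 2) (hopt : ‖x - c₀‖ ^ 2 + s = ‖a - c₀‖ ^ 2)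
    (j : Fin p) : ‖x - C (σ j)‖ ^ 2 + s = r ^ 2 := by
  classical
  by_contra hne
  have hlt : ‖x - C (σ j)‖ ^ 2 + s < r ^ 2 := lt_of_le_of_ne (hx _) hne
  obtain ⟨u, hu⟩ := hpre (fun k => if k = σ j then -(∑ i ∈ Finset.univ.erase j, α i) / α j else 1)
    (by
      rw [← Finset.add_sum_erase _ _ (Finset.mem_univ j)]
      have : ∀ i ∈ Finset.univ.erase j, α i * (if σ i = σ j then
          -(∑ i ∈ Finset.univ.erase j, α i) / α j else 1) = α i := fun i hi => by
        rw [if_neg (hσ.ne (Finset.ne_of_mem_erase hi)), mul_one]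
      rw [Finset.sum_congr rfl this, if_pos rfl, mul_div_cancel₀ _ (hα j).ne']
      ring)
  obtain ⟨M, hM⟩ : ∃ M : ℝ, ∀ k, ⟪d, C k - c₀⟫_ℝ ≠ 0 → 1 ≤ ⟪u - M • d, C k - c₀⟫_ℝ := by
    obtain ⟨M, hM⟩ := (Set.finite_range fun k : Fin m =>
      (1 - ⟪u, C k - c₀⟫_ℝ) / -⟪d, C k - c₀⟫_ℝ).bddAbove
    refine ⟨M, fun k hk => ?_⟩
    have hpos : 0 < -⟪d, C k - c₀⟫_ℝ := neg_pos.2 (lt_of_le_of_ne (hd k) hk)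
    have := (div_le_iff₀ hpos).1 (hM ⟨k, rfl⟩)
    rw [inner_sub_left, real_inner_smul_left]
    linarith
  set w := u - M • d with hw
  have hw1 : ∀ k, k ≠ σ j → 1 ≤ ⟪w, C k - c₀⟫_ℝ := fun k hk => by
    by_cases hdk : ⟪d, C k - c₀⟫_ℝ = 0
    · rw [hw, inner_sub_left, real_inner_smul_left, hdk, hu k hdk, if_neg hk]
      linarith
    · exact hM k hdk
  -- Move along `w`, keeping the relaxed objective equal to its old value plus `ε`.
  let slack : ℝ → ℝ := fun ε => ‖x - c₀‖ ^ 2 + s + ε - ‖x + ε • w - c₀‖ ^ 2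
  have hslack : Continuous slack := by fun_prop
  have hev1 : ∀ᶠ ε in nhds (0 : ℝ), 0 < slack ε :=
    hslack.continuousAt.eventually (lt_mem_nhds (by simpa [slack] using hs))
  have hcont2 : Continuous fun ε : ℝ => ‖x + ε • w - C (σ j)‖ ^ 2 + slack ε := by fun_prop
  have hev2 : ∀ᶠ ε in nhds (0 : ℝ), ‖x + ε • w - C (σ j)‖ ^ 2 + slack ε < r ^ 2 :=
    hcont2.continuousAt.eventually (gt_mem_nhds (by simpa [slack] using hlt))
  obtain ⟨ε, ⟨h1, h2⟩, hε⟩ := (((hev1.and hev2).filter_mono nhdsWithin_le_nhds).and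
    (self_mem_nhdsWithin (s := Set.Ioi (0 : ℝ)) (a := 0))).exists
  have hε : 0 < ε := hε
  have hexp : ∀ c, ‖x + ε • w - c‖ ^ 2
      = ‖x - c‖ ^ 2 + 2 * ε * ⟪w, x - c⟫_ℝ + ε ^ 2 * ‖w‖ ^ 2 := fun c => by
    have := norm_sub_smul_sub_sq x w c (-ε)
    rw [neg_smul, sub_neg_eq_add] at this
    rw [this]
    ring
  have hfeas : ∀ k, ‖x + ε • w - C k‖ ^ 2 + slack ε ≤ r ^ 2 := fun k => by
    by_cases hk : k = σ j
    · rw [hk]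
      exact h2.le
    · have hsplit : ⟪w, x - C k⟫_ℝ = ⟪w, x - c₀⟫_ℝ - ⟪w, C k - c₀⟫_ℝ := by
        rw [← inner_sub_right]
        congr 1
        abel
      have := mul_le_mul_of_nonneg_left (hw1 k hk) hε.le
      simp only [slack]
      rw [hexp, hexp, hsplit]
      linarith [hx k]
  have := relaxed_le_of_mem_farthestPoints hr hd0 hd ha h1.le hfeas
  simp only [slack] at this
  linarith

end Solutions

theorem lemma1 (n m : ℕ) (hnm : n < m) (C : Fin m → EuclideanSpace ℝ (Fin n))
    (hC : FacetsInGeneralPosition C) (r : ℝ) (hr : 0 < r)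
    (hQ : (ballIntersection C r).Nonempty)
    (C₀ : EuclideanSpace ℝ (Fin n)) (hC₀ : C₀ ∈ frontier (centerHull C))
    (p : ℕ) (hp : p ≤ n) (σ : Fin p → Fin m) (hσ : Function.Injective σ)
    (α : Fin p → ℝ) (hα : ∀ k, 0 < α k) (hα_sum : ∑ k, α k = 1)
    (hcomb : C₀ = ∑ k, α k • C (σ k)) :
    (p = n → (farthestPoints (ballIntersection C r) C₀).ncard = 1 ∨
      (farthestPoints (ballIntersection C r) C₀).ncard = 2) ∧
    (p < n → (farthestPoints (ballIntersection C r) C₀).ncard = 1 ∨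
      ¬ (farthestPoints (ballIntersection C r) C₀).Countable) := by
  classical
  have : Nonempty (Fin m) := ⟨⟨n, hnm⟩⟩
  obtain ⟨d, hd0, hd, hspan, hcard⟩ := exists_facet_normal hC hC₀
  set A := Finset.univ.filter fun k => ⟪d, C k - C₀⟫_ℝ = 0 with hA
  have hmemA : ∀ k, k ∈ A ↔ ⟪d, C k - C₀⟫_ℝ = 0 := fun k => by simp [hA]
  have hrel : ∑ j, α j • (C (σ j) - C₀) = 0 := by
    simp only [smul_sub, Finset.sum_sub_distrib]
    rw [← Finset.sum_smul, hα_sum, one_smul, ← hcomb, sub_self]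
  have hσA : ∀ j, σ j ∈ A := fun j => by
    have h0 : ∑ j, α j * ⟪d, C (σ j) - C₀⟫_ℝ = 0 := by
      simp only [← real_inner_smul_right, ← inner_sum]
      rw [hrel, inner_zero_right]
    have h1 := (Finset.sum_eq_zero_iff_of_nonpos fun j _ =>
      mul_nonpos_of_nonneg_of_nonpos (hα j).le (hd (σ j))).1 h0 j (Finset.mem_univ j)
    exact (hmemA _).2 ((mul_eq_zero.1 h1).resolve_left (hα j).ne')
  obtain ⟨hcardA, hpre⟩ := exists_inner_eq (v := fun k => C k - C₀) hd0 (fun k hk => (hmemA k).1 hk)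
    (fun e he => hspan e fun k hk => he k ((hmemA k).2 hk)) hσA hα_sum hrel (by simpa using hcard)
  rw [finrank_euclideanSpace_fin] at hcardA
  have hpre' : ∀ y : Fin m → ℝ, ∑ j, α j * y (σ j) = 0 →
      ∃ u, ∀ k, ⟪d, C k - C₀⟫_ℝ = 0 → ⟪u, C k - C₀⟫_ℝ = y k := fun y hy => by
    obtain ⟨u, hu⟩ := hpre y hy
    exact ⟨u, fun k hk => hu k ((hmemA k).2 hk)⟩
  set S := farthestPoints (ballIntersection C r) C₀ with hS
  obtain ⟨a, ha⟩ : S.Nonempty := farthestPoints_nonempty hQ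
  by_cases huniq : ∀ b ∈ S, b = a
  · have : S.ncard = 1 := Set.ncard_eq_one.2 ⟨a, Set.eq_singleton_iff_unique_mem.2 ⟨ha, huniq⟩⟩
    exact ⟨fun _ => Or.inl this, fun _ => Or.inl this⟩
  push Not at huniq
  obtain ⟨b, hb, hba⟩ := huniq
  have hmem : ∀ {x}, x ∈ S → ∀ k, ‖x - C k‖ ^ 2 ≤ r ^ 2 := fun hx =>
    (mem_ballIntersection_iff hr.le).1 hx.1
  have hfeas : ∀ {b}, b ∈ S → ∀ k, ‖midpoint ℝ a b - C k‖ ^ 2 + ‖a - b‖ ^ 2 / 4 ≤ r ^ 2 :=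
    fun hb k => by
      rw [norm_midpoint_sub_sq]
      linarith [hmem ha k, hmem hb k]
  have hopt : ∀ {b}, b ∈ S → ‖midpoint ℝ a b - C₀‖ ^ 2 + ‖a - b‖ ^ 2 / 4 = ‖a - C₀‖ ^ 2 :=
    fun hb => by
      rw [norm_midpoint_sub_sq, norm_eq_of_mem_farthestPoints hb ha]
      ring
  have hslack : ∀ {b}, b ≠ a → 0 < ‖a - b‖ ^ 2 / 4 := fun {b} hba => by
    have : 0 < ‖a - b‖ := norm_sub_pos_iff.2 hba.symm
    positivity
  constructor
  · intro hpn
    have hAσ : ∀ k ∈ A, ∃ j, σ j = k := by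
      have himg : Finset.univ.image σ = A := by
        apply Finset.eq_of_subset_of_card_le
        · intro k hk
          obtain ⟨j, -, rfl⟩ := Finset.mem_image.1 hk
          exact hσA j
        · rw [Finset.card_image_of_injective _ hσ, Finset.card_univ, Fintype.card_fin, hpn]
          exact hcard
      intro k hk
      rw [← himg] at hk
      simpa using hk
    have hline : ∀ b ∈ S, b ≠ a → ∃ c : ℝ, a - b = c • d := fun b hb hba => by
      refine hspan _ fun k hk => ?_
      obtain ⟨j, rfl⟩ := hAσ k ((hmemA k).2 hk)
      have h1 := relaxed_tight hr.le hd0 hd hσ hα hpre' ha (hslack hba) (hfeas hb) (hopt hb) j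
      rw [norm_midpoint_sub_sq] at h1
      have h2 : ‖a - C (σ j)‖ ^ 2 = ‖b - C (σ j)‖ ^ 2 := by
        linarith [hmem ha (σ j), hmem hb (σ j)]
      have h3 : ‖a - C₀‖ ^ 2 = ‖b - C₀‖ ^ 2 := by rw [norm_eq_of_mem_farthestPoints ha hb]
      have h4 := norm_sub_smul_sub_sq a (a - b) (C (σ j)) 1
      have h5 := norm_sub_smul_sub_sq a (a - b) C₀ 1
      rw [one_smul, sub_sub_cancel] at h4 h5
      rw [show C (σ j) - C₀ = (a - C₀) - (a - C (σ j)) by abel, inner_sub_right]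
      linarith
    right
    rw [Set.ncard_eq_two]
    refine ⟨a, b, hba.symm, Set.Subset.antisymm (fun c hc => ?_) ?_⟩
    · by_contra hne
      rw [Set.mem_insert_iff, Set.mem_singleton_iff, not_or] at hne
      obtain ⟨s, hs⟩ := hline b hb hba
      obtain ⟨t, ht⟩ := hline c hc hne.1
      have hbe : b = a - s • d := by rw [← hs, sub_sub_cancel]
      have hce : c = a - t • d := by rw [← ht, sub_sub_cancel]
      have := eq_or_eq_of_collinear_of_norm_eq (a := a) (c := C₀) (s := s) (t := t) (d := d)
        (by rw [← hbe]; exact norm_eq_of_mem_farthestPoints hb ha)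
        (by rw [← hce]; exact norm_eq_of_mem_farthestPoints hc ha)
        (by rw [← hs]; exact sub_ne_zero.2 hba.symm)
        (by rw [← ht]; exact sub_ne_zero.2 (Ne.symm hne.1))
      exact hne.2 (by rw [hbe, hce, this])
    · rintro x (rfl | rfl)
      exacts [ha, hb]
  · intro hpn
    right
    obtain ⟨k₀, hk₀A, hk₀σ⟩ : ∃ k ∈ A, ∀ j, σ j ≠ k := by
      by_contra! h
      have hsub : A ⊆ Finset.univ.image σ := fun k hk => by
        obtain ⟨j, hj⟩ := h k hk
        exact Finset.mem_image.2 ⟨j, Finset.mem_univ j, hj⟩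
      have := Finset.card_le_card hsub
      rw [Finset.card_image_of_injective _ hσ, Finset.card_univ, Fintype.card_fin] at this
      omega
    obtain ⟨e, he⟩ := hpre' (fun k => if ∃ j, σ j = k then 0 else -1)
      (Finset.sum_eq_zero fun j _ => by rw [if_pos ⟨j, rfl⟩, mul_zero])
    have hek₀ : ⟪e, C k₀ - C₀⟫_ℝ = -1 := by
      rw [he k₀ ((hmemA _).1 hk₀A), if_neg (by push Not; exact hk₀σ)]
    have hdk₀ := (hmemA _).1 hk₀A
    -- The vectors `d + ε • e` with small `ε ≥ 0` are normal as well.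
    obtain ⟨δ, hδ, hnormal⟩ : ∃ δ > (0 : ℝ), ∀ ε ∈ Set.Ioo 0 δ, ∀ k, ⟪d + ε • e, C k - C₀⟫_ℝ ≤ 0 := by
      have hev : ∀ᶠ ε : ℝ in nhdsWithin 0 (Set.Ioi 0), ∀ k, ⟪d + ε • e, C k - C₀⟫_ℝ ≤ 0 := by
        rw [Filter.eventually_all]
        intro k
        by_cases hk : ⟪d, C k - C₀⟫_ℝ = 0
        · filter_upwards [self_mem_nhdsWithin] with ε hε
          have hε : 0 < ε := hε
          rw [inner_add_left, real_inner_smul_left, hk, he k hk]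
          split_ifs <;> linarith
        · have hcont : Continuous fun ε : ℝ => ⟪d + ε • e, C k - C₀⟫_ℝ := by fun_prop
          have := (hcont.continuousAt (x := 0)).eventually_lt_const (u := 0)
            (by simpa using lt_of_le_of_ne (hd k) hk)
          exact (this.mono fun _ h => h.le).filter_mono nhdsWithin_le_nhds
      obtain ⟨δ, hδ, hsub⟩ := (mem_nhdsGT_iff_exists_Ioo_subset).1 hev
      exact ⟨δ, hδ, fun ε hε => hsub hε⟩
    have hne0 : ∀ ε ∈ Set.Ioo 0 δ, d + ε • e ≠ 0 := fun ε hε h => by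
      have h1 : ⟪d + ε • e, C k₀ - C₀⟫_ℝ = 0 := by rw [h, inner_zero_left]
      rw [inner_add_left, real_inner_smul_left, hdk₀, hek₀] at h1
      linarith [hε.1]
    set x := midpoint ℝ a b with hx
    have hex : ∀ ε : Set.Ioo 0 δ, ∃ t : ℝ, 0 < t ∧ x - t • (d + (ε : ℝ) • e) ∈ S := fun ε => by
      obtain ⟨t, ht0, ht, htk⟩ := exists_move_against_normal (hne0 ε ε.2) (hnormal ε ε.2) x
        (hslack hba).le
      refine ⟨t, lt_of_le_of_ne ht0 ?_, ?_, ?_⟩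
      · rintro rfl
        rw [zero_smul, sub_zero] at ht
        linarith [hslack hba]
      · exact (mem_ballIntersection_iff hr.le).2 fun k => (htk k).trans (hfeas hb k)
      · intro y hy
        rw [hopt hb] at ht
        rw [(pow_left_inj₀ (norm_nonneg _) (norm_nonneg _) two_ne_zero).1 ht]
        exact ha.2 y hy
    choose t ht0 htS using hex
    intro hcount
    have hinj : Function.Injective fun ε : Set.Ioo 0 δ =>
        (⟨x - t ε • (d + (ε : ℝ) • e), htS ε⟩ : S) := by
      intro ε ε' h
      have h1 : t ε • (d + (ε : ℝ) • e) = t ε' • (d + (ε' : ℝ) • e) :=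
        sub_right_injective (Subtype.ext_iff.1 h)
      have h2 : t ε * ε = t ε' * ε' := by
        have := congrArg (fun u => ⟪u, C k₀ - C₀⟫_ℝ) h1
        simp only [real_inner_smul_left, inner_add_left, hdk₀, hek₀] at this
        linarith
      rw [smul_add, smul_add, smul_smul, smul_smul, h2, add_left_inj] at h1
      have h3 : t ε = t ε' := smul_left_injective ℝ hd0 h1
      rw [h3] at h2
      exact Subtype.ext (mul_left_cancel₀ (ht0 ε').ne' h2)
    have := hcount.to_subtype
    have hc : (Set.Ioo 0 δ).Countable := Set.countable_coe_iff.1 hinj.countable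
    have h0 : MeasureTheory.volume (Set.Ioo 0 δ) = 0 := hc.measure_zero _
    rw [Real.volume_Ioo, sub_zero, ENNReal.ofReal_eq_zero] at h0
    exact absurd hδ (not_lt.2 h0)
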